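/- Let $M$ be a real-analytic manifold of dimension three, $L$ an analytic field of endomorphisms of its tangent spaces and $e$ an analytic vector field on $M$, such that $(L,e)$ is a Nijenhuis operator with a unity, that is, $$[L\xi,L\eta]+L^2[\xi,\eta]-L[L\xi,\eta]-L[\xi,L\eta]=0,\qquad \mathcal L_e L=\operatorname{Id}$$ for all vector fields $\xi,\eta$. Let $p_0\in M$, and suppose that near $p_0$ there are analytic coordinates $(x^1,x^2,x^3)$, all vanishing at $p_0$, in which $(L,e)$ has the semi-normal form $$e=\frac{\partial}{\partial x^1},\qquad L=\begin{pmatrix} x^1+\lambda_0&0&0\\ \frac{x^2}{k}&\varepsilon (x^2)^k+x^1+\lambda_0&0\\ f(x^2,x^3)&g(x^2,x^3)&\varepsilon (x^2)^k+x^1+\lambda_0\end{pmatrix},$$ where $k\ge 1$ is an integer, $\varepsilon\in\{1,-1\}$, $\lambda_0\in\mathbb R$, and $f,g$ are analytic functions near $(0,0)$. (Thus $L$ has two distinct eigenvalues at generic points near $p_0$ and the single eigenvalue $\lambda_0$ at $p_0$.) Assume that $g(0,0)\neq 0$ and, if $k=1$, also that $f(0,0)=0$. Then there exists an analytic coordinate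 system $(x^1,x^2,x^3)$ in a neighbourhood of $p_0$ in which, with the same $k,\varepsilon,\lambda_0$, $$e=\frac{\partial}{\partial x^1},\qquad L=\begin{pmatrix} x^1+\lambda_0&0&0\\ \frac{x^2}{k}&\varepsilon (x^2)^k+x^1+\lambda_0&0\\ \frac{1-k}{k}x^3&1&\varepsilon (x^2)^k+x^1+\lambda_0\end{pmatrix},$$ so that the normal form contains no functional parameters. These coordinates can be chosen so that $x^1(p_0)=x^2(p_0)=0$ and, if $f(0,0)=0$, also $x^3(p_0)=0$. -/

import Mathlib

open scoped Manifold ContDiff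

/-- The space of values of a coordinate system `(x¹, x², x³)`; the coordinates are indexed
by `0, 1, 2 : Fin 3`. -/
abbrev Coord3 : Type := EuclideanSpace ℝ (Fin 3)

section

variable {M : Type*} [TopologicalSpace M] [ChartedSpace Coord3 M]

/-- The vector field `ξ` is analytic at `p`, that is, in a neighbourhood of `p`. -/
def VectorFieldAnalyticAt [IsManifold (𝓡 3) ω M] (ξ : (p : M) → TangentSpace (𝓡 3) p)
    (p : M) : Prop :=
  ContMDiffAt (𝓡 3) (𝓡 3).tangent ω (fun q => (⟨q, ξ q⟩ : TangentBundle (𝓡 3) M)) p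

/-- The operator field (field of endomorphisms of the tangent spaces) `L` is analytic, as a
section of the bundle `Hom(TM, TM)`. -/
def OperatorFieldAnalytic [IsManifold (𝓡 3) ω M]
    (L : (p : M) → TangentSpace (𝓡 3) p →L[ℝ] TangentSpace (𝓡 3) p) : Prop :=
  ContMDiff (𝓡 3) ((𝓡 3).prod 𝓘(ℝ, Coord3 →L[ℝ] Coord3)) ω
    (fun p => Bundle.TotalSpace.mk' (Coord3 →L[ℝ] Coord3)
      (E := fun q : M => TangentSpace (𝓡 3) q →L[ℝ] TangentSpace (𝓡 3) q) p (L p))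

/-- The Nijenhuis torsion
`N_L(ξ, η) = [Lξ, Lη] + L²[ξ, η] - L[Lξ, η] - L[ξ, Lη]` at the point `p`. -/
noncomputable def nijenhuisTorsion
    (L : (p : M) → TangentSpace (𝓡 3) p →L[ℝ] TangentSpace (𝓡 3) p)
    (ξ η : (p : M) → TangentSpace (𝓡 3) p) (p : M) : TangentSpace (𝓡 3) p :=
  VectorField.mlieBracket (𝓡 3) (fun q => L q (ξ q)) (fun q => L q (η q)) p
    + L p (L p (VectorField.mlieBracket (𝓡 3) ξ η p))
    - L p (VectorField.mlieBracket (𝓡 3) (fun q => L q (ξ q)) η p)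
    - L p (VectorField.mlieBracket (𝓡 3) ξ (fun q => L q (η q)) p)

/-- The Lie derivative of an operator field `L` along `e`, applied to a vector field `ξ`:
`(𝓛_e L) ξ = [e, Lξ] - L[e, ξ]` at the point `p`. -/
noncomputable def lieDerivOperator (e : (p : M) → TangentSpace (𝓡 3) p)
    (L : (p : M) → TangentSpace (𝓡 3) p →L[ℝ] TangentSpace (𝓡 3) p)
    (ξ : (p : M) → TangentSpace (𝓡 3) p) (p : M) : TangentSpace (𝓡 3) p :=
  VectorField.mlieBracket (𝓡 3) e (fun q => L q (ξ q)) p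
    - L p (VectorField.mlieBracket (𝓡 3) e ξ p)

/-- `(L, e)` is a Nijenhuis operator with a unity, in the analytic category: `N_L = 0` and
`𝓛_e L = Id`. Both identities are between tensors; they are tested, at each point, on
vector fields that are defined and analytic near that point. -/
structure IsNijenhuisWithUnity [IsManifold (𝓡 3) ω M]
    (L : (p : M) → TangentSpace (𝓡 3) p →L[ℝ] TangentSpace (𝓡 3) p)
    (e : (p : M) → TangentSpace (𝓡 3) p) : Prop where
  analytic_operator : OperatorFieldAnalytic L
  analytic_unity : ∀ p, VectorFieldAnalyticAt e p
  torsion_eq_zero : ∀ (p : M) (ξ η : (q : M) → TangentSpace (𝓡 3) q),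
    VectorFieldAnalyticAt ξ p → VectorFieldAnalyticAt η p → nijenhuisTorsion L ξ η p = 0
  lieDeriv_eq_id : ∀ (p : M) (ξ : (q : M) → TangentSpace (𝓡 3) q),
    VectorFieldAnalyticAt ξ p → lieDerivOperator e L ξ p = ξ p

/-- The differential at `p` of a coordinate system `φ`: it sends a tangent vector to the
column of its components with respect to `∂/∂x¹, ∂/∂x², ∂/∂x³`. -/
noncomputable def coordDiff (φ : OpenPartialHomeomorph M Coord3) (p : M) :
    TangentSpace (𝓡 3) p →L[ℝ] Coord3 :=
  mfderiv (𝓡 3) (𝓡 3) φ p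

/-- On the whole domain of the coordinate system `φ`, `e = ∂/∂x¹` and `L` has the matrix
`A(x¹, x², x³)` (acting on columns of components). -/
def HasCoordForm (L : (p : M) → TangentSpace (𝓡 3) p →L[ℝ] TangentSpace (𝓡 3) p)
    (e : (p : M) → TangentSpace (𝓡 3) p) (φ : OpenPartialHomeomorph M Coord3)
    (A : Coord3 → Matrix (Fin 3) (Fin 3) ℝ) : Prop :=
  ∀ p ∈ φ.source,
    coordDiff φ p (e p) = EuclideanSpace.single 0 1 ∧
    ∀ v : TangentSpace (𝓡 3) p,
      coordDiff φ p (L p v) = Matrix.toEuclideanLin (A (φ p)) (coordDiff φ p v)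

end

/-- The matrix of the semi-normal form with parameters `k`, `lam0`, the sign `ε = ±1` and the
functions `f(x², x³)`, `g(x², x³)`. -/
noncomputable def semiNormalMatrix (ε : ℝ) (k : ℕ) (lam0 : ℝ) (f g : ℝ × ℝ → ℝ)
    (x : Coord3) : Matrix (Fin 3) (Fin 3) ℝ :=
  !![x 0 + lam0, 0, 0;
     x 1 / k, ε * x 1 ^ k + x 0 + lam0, 0;
     f (x 1, x 2), g (x 1, x 2), ε * x 1 ^ k + x 0 + lam0]

/-!
Write `y = (y₁, y₂)` for the last two coordinates and consider the plane fields
`X = (y₁ / k) ∂₁ + f ∂₂` and `Y = g ∂₂`. Vanishing of the torsion of the semi-normal form means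
`[X, Y] = (1 - 1 / k) Y`, and a function `Z` of `y`, taken as new third coordinate, brings the
matrix to the normal form when `X Z = ((1 - k) / k) Z` and `Y Z = 1`.

The Euler field is `D = y₁ ∂₁ + y₂ ∂₂ = k X + H Y` with `H = (y₂ - k f) / g`, so `Z` has to satisfy
`D Z + (k - 1) Z = H`. This is solved degree by degree in the power series of `H`; the only
obstruction is the constant term when `k = 1`, whence the assumption `f(0, 0) = 0` in that case.
Conversely, for such a `Z` the bracket relation implies that `∂₂ Z` and `1 / g` both solve
`D u + k u = ∂₂ H`, whose solution near the origin is unique; hence `Y Z = 1`, and then the equation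
for `X Z` is the equation for `D Z`.
-/

open Filter Topology

section EulerField

variable {𝕜 E G : Type*} [NormedAddCommGroup E] [NormedAddCommGroup G]

section NontriviallyNormedField

variable [NontriviallyNormedField 𝕜] [NormedSpace 𝕜 E] [NormedSpace 𝕜 G]

variable (𝕜) in
/-- The derivative `D u` of `u` along the Euler vector field `D`, whose value at `x` is `x`. -/
noncomputable def eulerDeriv (u : E → G) (x : E) : G := fderiv 𝕜 u x x

theorem hasSum_eulerDeriv [CompleteSpace G] {u : E → G} {p : FormalMultilinearSeries 𝕜 E G}
    {r : ENNReal} (hp : HasFPowerSeriesOnBall u p 0 r) {x : E} (hx : x ∈ Metric.eball 0 r) :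
    HasSum (fun n : ℕ => n • p n fun _ => x) (eulerDeriv 𝕜 u x) := by
  have h := (hp.fderiv.hasSum hx).mapL (ContinuousLinearMap.apply 𝕜 G x)
  simp only [zero_add, ContinuousLinearMap.apply_apply,
    FormalMultilinearSeries.derivSeries_apply_diag] at h
  rw [← hasSum_nat_add_iff' 1]
  simpa [eulerDeriv] using h

-- The commutator of `∂_v` with the Euler field is `∂_v`.
theorem eulerDeriv_fderiv_apply_add {n : ℕ∞ω} (hn : minSmoothness 𝕜 2 ≤ n) {u : E → G} {x : E}
    (hu : ContDiffAt 𝕜 n u x) (v : E) :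
    eulerDeriv 𝕜 (fun y => fderiv 𝕜 u y v) x + fderiv 𝕜 u x v =
      fderiv 𝕜 (eulerDeriv 𝕜 u) x v := by
  have hu' : HasFDerivAt (fderiv 𝕜 u) (fderiv 𝕜 (fderiv 𝕜 u) x) x :=
    ((hu.fderiv_right (m := 1) (le_minSmoothness.trans hn)).differentiableAt
      one_ne_zero).hasFDerivAt
  have hv : fderiv 𝕜 (fun y => fderiv 𝕜 u y v) x = (fderiv 𝕜 (fderiv 𝕜 u) x).flip v := by
    simpa using (hu'.clm_apply (hasFDerivAt_const v x)).fderiv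
  have hD : fderiv 𝕜 (eulerDeriv 𝕜 u) x v =
      fderiv 𝕜 u x v + fderiv 𝕜 (fderiv 𝕜 u) x v x :=
    congrArg (fun T : E →L[𝕜] G => T v) (hu'.clm_apply (hasFDerivAt_id x)).fderiv
  rw [hD, eulerDeriv, hv, ContinuousLinearMap.flip_apply,
    (hu.isSymmSndFDerivAt hn).eq x v, add_comm]

theorem eulerDeriv_fderiv_apply_add_smul {n : ℕ∞ω} (hn : minSmoothness 𝕜 2 ≤ n) {u F : E → G}
    {x : E} (hu : ContDiffAt 𝕜 n u x) {a : 𝕜}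
    (h : ∀ᶠ y in 𝓝 x, eulerDeriv 𝕜 u y + a • u y = F y) (v : E) :
    eulerDeriv 𝕜 (fun y => fderiv 𝕜 u y v) x + (a + 1) • fderiv 𝕜 u x v = fderiv 𝕜 F x v := by
  have hn₁ : (1 : ℕ∞ω) + 1 ≤ n := le_minSmoothness.trans hn
  have hu₁ : DifferentiableAt 𝕜 u x :=
    hu.differentiableAt (fun h0 => by simp [h0] at hn₁)
  have hD : DifferentiableAt 𝕜 (eulerDeriv 𝕜 u) x :=
    ((hu.fderiv_right (m := 1) hn₁).differentiableAt one_ne_zero).clm_apply differentiableAt_id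
  rw [← EventuallyEq.fderiv_eq h, fderiv_fun_add hD (hu₁.fun_const_smul a),
    fderiv_fun_const_smul hu₁, add_apply, ← eulerDeriv_fderiv_apply_add hn hu, add_smul,
    one_smul, smul_apply]
  abel

/-- The formal solution `q` of `D q + a q = p`: the Euler field multiplies the term of degree `n`
by `n`. When `n = a = 0` the convention `0⁻¹ = 0` makes the constant term vanish. -/
noncomputable def eulerResolvent (a : ℕ) (p : FormalMultilinearSeries 𝕜 E G) :
    FormalMultilinearSeries 𝕜 E G := fun n => ((n + a : ℕ) : 𝕜)⁻¹ • p n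

end NontriviallyNormedField

section RCLike

variable [RCLike 𝕜] [NormedSpace 𝕜 E] [NormedSpace 𝕜 G]

theorem radius_le_radius_eulerResolvent (a : ℕ) (p : FormalMultilinearSeries 𝕜 E G) :
    p.radius ≤ (eulerResolvent a p).radius := by
  refine FormalMultilinearSeries.radius_le_of_le fun n => ?_
  rw [eulerResolvent, norm_smul, norm_inv, RCLike.norm_natCast]
  exact mul_le_of_le_one_left (norm_nonneg _) (Nat.cast_inv_le_one _)

theorem nsmul_add_smul_eulerResolvent {a : ℕ} {p : FormalMultilinearSeries 𝕜 E G}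
    (h : a = 0 → p 0 = 0) (n : ℕ) :
    n • eulerResolvent a p n + (a : 𝕜) • eulerResolvent a p n = p n := by
  rw [← Nat.cast_smul_eq_nsmul 𝕜, ← add_smul, ← Nat.cast_add, eulerResolvent, smul_smul]
  rcases eq_or_ne (n + a) 0 with hna | hna
  · obtain ⟨rfl, rfl⟩ := Nat.add_eq_zero_iff.1 hna
    simp [h rfl]
  · rw [mul_inv_cancel₀ (Nat.cast_ne_zero.2 hna), one_smul]

theorem exists_analyticAt_eulerDeriv_add_smul_eq [CompleteSpace G] {F : E → G}
    (hF : AnalyticAt 𝕜 F 0) (a : ℕ) (ha : a = 0 → F 0 = 0) :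
    ∃ Z : E → G, AnalyticAt 𝕜 Z 0 ∧ (F 0 = 0 → Z 0 = 0) ∧
      ∀ᶠ x in 𝓝 0, eulerDeriv 𝕜 Z x + (a : 𝕜) • Z x = F x := by
  obtain ⟨p, r, hp⟩ := hF
  have hp0 : F 0 = 0 → p 0 = 0 := fun h =>
    ContinuousMultilinearMap.ext fun v => (hp.coeff_zero v).trans h
  set q := eulerResolvent a p with hq_def
  have hr : r ≤ q.radius := hp.r_le.trans (radius_le_radius_eulerResolvent a p)
  have hq : HasFPowerSeriesOnBall q.sum q 0 r :=
    (q.hasFPowerSeriesOnBall (hp.r_pos.trans_le hr)).mono hp.r_pos hr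
  refine ⟨q.sum, hq.analyticAt, fun h0 => ?_, ?_⟩
  · rw [← hq.coeff_zero 0, hq_def, eulerResolvent, hp0 h0, smul_zero]
    rfl
  · filter_upwards [Metric.eball_mem_nhds (0 : E) hp.r_pos] with x hx
    have hZ : HasSum (fun n => q n fun _ => x) (q.sum x) := by simpa using hq.hasSum hx
    have hFx : HasSum (fun n => p n fun _ => x) (F x) := by simpa using hp.hasSum hx
    refine ((hasSum_eulerDeriv hq hx).add (hZ.const_smul (a : 𝕜))).unique ?_
    convert hFx with n
    exact congrArg (fun P : E [×n]→L[𝕜] G => P fun _ => x)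
      (nsmul_add_smul_eulerResolvent (fun h => hp0 (ha h)) n)

end RCLike

section Real

variable [NormedSpace ℝ E] [NormedSpace ℝ G]

theorem hasDerivAt_pow_smul_comp_smul {u : E → G} {x : E} {t : ℝ}
    (hu : DifferentiableAt ℝ u (t • x)) (m : ℕ) :
    HasDerivAt (fun s : ℝ => s ^ (m + 1) • u (s • x))
      (t ^ m • (eulerDeriv ℝ u (t • x) + (m + 1 : ℝ) • u (t • x))) t := by
  have hux : HasDerivAt (fun s : ℝ => u (s • x)) (fderiv ℝ u (t • x) x) t := by
    simpa using! hu.hasFDerivAt.comp_hasDerivAt t ((hasDerivAt_id t).smul_const x)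
  refine ((hasDerivAt_pow (m + 1) t).smul hux).congr_deriv ?_
  rw [eulerDeriv, map_smul, Nat.add_sub_cancel]
  push_cast
  module

theorem eventually_eq_zero_of_eulerDeriv_add_smul_eq_zero {u : E → G} {m : ℕ}
    (hu : ∀ᶠ x in 𝓝 0, DifferentiableAt ℝ u x)
    (h : ∀ᶠ x in 𝓝 0, eulerDeriv ℝ u x + (m + 1 : ℝ) • u x = 0) : ∀ᶠ x in 𝓝 0, u x = 0 := by
  obtain ⟨r, hr, hball⟩ := Metric.eventually_nhds_iff_ball.1 (hu.and h)
  filter_upwards [Metric.ball_mem_nhds (0 : E) hr] with x hx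
  have hderiv : ∀ t ∈ Set.Icc (0 : ℝ) 1,
      HasDerivAt (fun s : ℝ => s ^ (m + 1) • u (s • x)) 0 t := by
    intro t ht
    obtain ⟨hd, h0⟩ := hball _ ((convex_ball 0 r).smul_mem_of_zero_mem (Metric.mem_ball_self hr)
      hx ht)
    simpa only [h0, smul_zero] using hasDerivAt_pow_smul_comp_smul hd m
  have hconst := constant_of_has_deriv_right_zero
    (fun t ht => (hderiv t ht).continuousAt.continuousWithinAt)
    (fun t ht => (hderiv t (Set.Ico_subset_Icc_self ht)).hasDerivWithinAt) 1 (by simp)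
  simpa using hconst

theorem eventuallyEq_of_eulerDeriv_add_smul_eq {u w : E → G} {m : ℕ}
    (hu : ∀ᶠ x in 𝓝 0, DifferentiableAt ℝ u x) (hw : ∀ᶠ x in 𝓝 0, DifferentiableAt ℝ w x)
    (h : ∀ᶠ x in 𝓝 0, eulerDeriv ℝ u x + (m + 1 : ℝ) • u x =
      eulerDeriv ℝ w x + (m + 1 : ℝ) • w x) : u =ᶠ[𝓝 0] w := by
  suffices h0 : ∀ᶠ x in 𝓝 0, (u - w) x = 0 from h0.mono fun x hx => sub_eq_zero.1 hx
  refine eventually_eq_zero_of_eulerDeriv_add_smul_eq_zero (m := m)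
    (hu.and hw |>.mono fun x hx => hx.1.sub hx.2) ?_
  filter_upwards [hu, hw, h] with x hux hwx hx
  rw [eulerDeriv, fderiv_sub hux hwx, sub_apply, Pi.sub_apply, smul_sub, sub_add_sub_comm]
  exact sub_eq_zero.2 hx

end Real

end EulerField

section PlaneFields

variable {f g : ℝ × ℝ → ℝ}

theorem map_zero_prodMk (T : ℝ × ℝ →L[ℝ] ℝ) (c : ℝ) : T (0, c) = c * T (0, 1) := by
  rw [← smul_eq_mul, ← map_smul, Prod.smul_mk, smul_zero, smul_eq_mul, mul_one]

theorem map_div_prodMk (T : ℝ × ℝ →L[ℝ] ℝ) {k : ℝ} (hk : k ≠ 0) (y : ℝ × ℝ) (c : ℝ) :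
    T (y.1 / k, c) = (T y - (y.2 - k * c) * T (0, 1)) / k := by
  have hy : (y.1 / k, c) = k⁻¹ • (y - (y.2 - k * c) • ((0, 1) : ℝ × ℝ)) := by
    ext
    · simp [div_eq_inv_mul]
    · simp [hk]
  rw [hy, map_smul, map_sub, map_smul, smul_eq_mul, smul_eq_mul, inv_mul_eq_div]

theorem eulerDeriv_inv_add_mul_inv {k : ℝ} (hk : k ≠ 0) {y : ℝ × ℝ}
    (hf : DifferentiableAt ℝ f y) (hg : DifferentiableAt ℝ g y) (hgy : g y ≠ 0)
    (hfg : fderiv ℝ g y (y.1 / k, f y) - fderiv ℝ f y (0, g y) = (1 - 1 / k) * g y) :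
    eulerDeriv ℝ (fun z => (g z)⁻¹) y + k * (g y)⁻¹ =
      fderiv ℝ (fun z => (z.2 - k * f z) * (g z)⁻¹) y (0, 1) := by
  have hinv : HasFDerivAt (fun z => (g z)⁻¹) (-(g y ^ 2)⁻¹ • fderiv ℝ g y) y :=
    (hasDerivAt_inv hgy).comp_hasFDerivAt y hg.hasFDerivAt
  have hsub : HasFDerivAt (fun z : ℝ × ℝ => z.2 - k * f z)
      (ContinuousLinearMap.snd ℝ ℝ ℝ - k • fderiv ℝ f y) y :=
    hasFDerivAt_snd.sub (hf.hasFDerivAt.const_mul k)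
  rw [map_div_prodMk _ hk, map_zero_prodMk (fderiv ℝ f y)] at hfg
  rw [eulerDeriv, hinv.fderiv, (hsub.fun_mul hinv).fderiv]
  simp only [add_apply, sub_apply, smul_apply, smul_eq_mul, ContinuousLinearMap.coe_snd']
  field_simp at hfg ⊢
  linear_combination -hfg

theorem exists_analyticAt_rectifying {k : ℕ} (hk : 1 ≤ k)
    (hf : AnalyticAt ℝ f 0) (hg : AnalyticAt ℝ g 0) (hg₀ : g 0 ≠ 0) (hf₀ : k = 1 → f 0 = 0)
    (hfg : ∀ᶠ y in 𝓝 0,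
      fderiv ℝ g y (y.1 / k, f y) - fderiv ℝ f y (0, g y) = (1 - 1 / (k : ℝ)) * g y) :
    ∃ Z : ℝ × ℝ → ℝ, AnalyticAt ℝ Z 0 ∧ (f 0 = 0 → Z 0 = 0) ∧
      ∀ᶠ y in 𝓝 0, fderiv ℝ Z y (y.1 / k, f y) = (1 - k) / k * Z y ∧
        fderiv ℝ Z y (0, g y) = 1 := by
  obtain ⟨m, rfl⟩ : ∃ m, k = m + 1 := ⟨k - 1, by omega⟩
  have hk₀ : ((m + 1 : ℕ) : ℝ) ≠ 0 := by positivity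
  set H : ℝ × ℝ → ℝ := fun y => (y.2 - (m + 1 : ℕ) * f y) * (g y)⁻¹ with hH
  have hHa : AnalyticAt ℝ H 0 :=
    (analyticAt_snd.sub (analyticAt_const.mul hf)).mul (hg.inv hg₀)
  have hH₀ : f 0 = 0 → H 0 = 0 := fun h => by simp [hH, h]
  -- With `X = (y₁ / k) ∂₁ + f ∂₂` and `Y = g ∂₂`, the Euler field is `k X + H Y`.
  obtain ⟨Z, hZ, hZ₀, hZH⟩ := exists_analyticAt_eulerDeriv_add_smul_eq hHa m
    (fun h => hH₀ (hf₀ (by omega)))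
  have hg_ne : ∀ᶠ y in 𝓝 0, g y ≠ 0 := hg.continuousAt.eventually_ne hg₀
  -- `∂₂ Z` and `1 / g` solve the same Euler equation `D u + k u = ∂₂ H`.
  have hZ₂ : (fun y => fderiv ℝ Z y (0, 1)) =ᶠ[𝓝 0] fun y => (g y)⁻¹ := by
    refine eventuallyEq_of_eulerDeriv_add_smul_eq (m := m) ?_ ?_ ?_
    · exact hZ.fderiv.eventually_analyticAt.mono fun y hy =>
        hy.differentiableAt.clm_apply (differentiableAt_const _)
    · exact (hg.inv hg₀).eventually_analyticAt.mono fun y hy => hy.differentiableAt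
    · filter_upwards [hf.eventually_analyticAt, hg.eventually_analyticAt, hg_ne,
        hZ.eventually_analyticAt, hZH.eventually_nhds, hfg] with y hfy hgy hgy₀ hZy hZHy hfgy
      rw [eulerDeriv_fderiv_apply_add_smul (n := ω) (by simp) hZy.contDiffAt hZHy, smul_eq_mul,
        hH, ← eulerDeriv_inv_add_mul_inv hk₀ hfy.differentiableAt hgy.differentiableAt hgy₀ hfgy]
      push_cast
      rfl
  refine ⟨Z, hZ, fun h => hZ₀ (hH₀ h), ?_⟩
  filter_upwards [hZ₂, hg_ne, hZH] with y hy hgy hZHy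
  refine ⟨?_, by rw [map_zero_prodMk, hy, mul_inv_cancel₀ hgy]⟩
  rw [map_div_prodMk _ hk₀, hy, div_mul_eq_mul_div]
  congr 1
  rw [eulerDeriv, smul_eq_mul, hH] at hZHy
  push_cast at hZHy ⊢
  linear_combination hZHy

end PlaneFields

section FlatTorsion

open VectorField

variable {𝕜 E : Type*} [NontriviallyNormedField 𝕜] [NormedAddCommGroup E] [NormedSpace 𝕜 E]

variable (𝕜) in
/-- The Nijenhuis torsion `[AV, AW] + A²[V, W] - A[AV, W] - A[V, AW]` of an operator field `A` on
a normed space: the expression of `nijenhuisTorsion` in coordinates. -/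
noncomputable def flatNijenhuisTorsion (A : E → E →ₗ[𝕜] E) (V W : E → E) (x : E) : E :=
  lieBracket 𝕜 (fun y => A y (V y)) (fun y => A y (W y)) x + A x (A x (lieBracket 𝕜 V W x))
    - A x (lieBracket 𝕜 (fun y => A y (V y)) W x) - A x (lieBracket 𝕜 V (fun y => A y (W y)) x)

theorem flatNijenhuisTorsion_const (A : E → E →ₗ[𝕜] E) (v w x : E) :
    flatNijenhuisTorsion 𝕜 A (fun _ => v) (fun _ => w) x =
      fderiv 𝕜 (fun y => A y w) x (A x v) - fderiv 𝕜 (fun y => A y v) x (A x w)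
        + A x (fderiv 𝕜 (fun y => A y v) x w) - A x (fderiv 𝕜 (fun y => A y w) x v) := by
  simp [flatNijenhuisTorsion, lieBracket]

end FlatTorsion

section CoordinateExpressions

open VectorField

variable {M : Type*} [TopologicalSpace M] [ChartedSpace Coord3 M]
  {φ : OpenPartialHomeomorph M Coord3} {p : M}
  {L : (p : M) → TangentSpace (𝓡 3) p →L[ℝ] TangentSpace (𝓡 3) p}
  {A : Coord3 → Matrix (Fin 3) (Fin 3) ℝ}

theorem isInvertible_coordDiff (hφ : φ ∈ IsManifold.maximalAtlas (𝓡 3) ω M) (hp : p ∈ φ.source) :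
    (coordDiff φ p).IsInvertible := by
  have h : φ.MDifferentiable (𝓡 3) (𝓡 3) :=
    ⟨(contMDiffOn_of_mem_maximalAtlas hφ).mdifferentiableOn (by simp),
      (contMDiffOn_symm_of_mem_maximalAtlas hφ).mdifferentiableOn (by simp)⟩
  exact ⟨h.mfderiv hp, rfl⟩

theorem coordDiff_trans (hφ : φ ∈ IsManifold.maximalAtlas (𝓡 3) ω M) (hp : p ∈ φ.source)
    {Θ : OpenPartialHomeomorph Coord3 Coord3} (hΘ : DifferentiableAt ℝ Θ (φ p))
    (v : TangentSpace (𝓡 3) p) :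
    coordDiff (φ.trans Θ) p v = fderiv ℝ Θ (φ p) (coordDiff φ p v) := by
  have hcomp := mfderiv_comp (I := 𝓡 3) (I' := 𝓡 3) (I'' := 𝓡 3) p hΘ.mdifferentiableAt
    ((contMDiffAt_of_mem_maximalAtlas hφ hp).mdifferentiableAt (by simp))
  rw [mfderiv_eq_fderiv] at hcomp
  exact congrArg (fun T : TangentSpace (𝓡 3) p →L[ℝ] Coord3 => T v) hcomp

theorem HasCoordForm.trans {e : (p : M) → TangentSpace (𝓡 3) p} (hform : HasCoordForm L e φ A)
    (hφ : φ ∈ IsManifold.maximalAtlas (𝓡 3) ω M) {Θ : OpenPartialHomeomorph Coord3 Coord3}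
    {B : Coord3 → Matrix (Fin 3) (Fin 3) ℝ} (hΘ : ∀ x ∈ Θ.source, DifferentiableAt ℝ Θ x)
    (hunity : ∀ x ∈ Θ.source,
      fderiv ℝ Θ x (EuclideanSpace.single 0 1) = EuclideanSpace.single 0 1)
    (hAB : ∀ x ∈ Θ.source, ∀ v, fderiv ℝ Θ x (Matrix.toEuclideanLin (A x) v) =
      Matrix.toEuclideanLin (B (Θ x)) (fderiv ℝ Θ x v)) :
    HasCoordForm L e (φ.trans Θ) B := by
  intro p hp'
  rw [OpenPartialHomeomorph.trans_source] at hp'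
  obtain ⟨hp, hpΘ : φ p ∈ Θ.source⟩ := hp'
  obtain ⟨he, hL⟩ := hform p hp
  refine ⟨?_, fun v => ?_⟩
  · rw [coordDiff_trans hφ hp (hΘ _ hpΘ), he, hunity _ hpΘ]
  · rw [coordDiff_trans hφ hp (hΘ _ hpΘ), coordDiff_trans hφ hp (hΘ _ hpΘ), hL, hAB _ hpΘ]
    rfl

/-- The vector field on `M` with components `V` in the coordinates `φ`. -/
noncomputable def ofComponents (φ : OpenPartialHomeomorph M Coord3) (V : Coord3 → Coord3) (q : M) :
    TangentSpace (𝓡 3) q :=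
  mpullback (𝓡 3) (𝓡 3) φ V q

theorem coordDiff_ofComponents (hφ : φ ∈ IsManifold.maximalAtlas (𝓡 3) ω M) (hp : p ∈ φ.source)
    (V : Coord3 → Coord3) : coordDiff φ p (ofComponents φ V p) = V (φ p) :=
  (isInvertible_coordDiff hφ hp).self_apply_inverse _

theorem eventuallyEq_ofComponents_of_coordDiff_apply
    (hφ : φ ∈ IsManifold.maximalAtlas (𝓡 3) ω M) (hp : p ∈ φ.source)
    (hL : ∀ q ∈ φ.source, ∀ v : TangentSpace (𝓡 3) q,
      coordDiff φ q (L q v) = Matrix.toEuclideanLin (A (φ q)) (coordDiff φ q v))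
    (V : Coord3 → Coord3) :
    (fun q => L q (ofComponents φ V q)) =ᶠ[𝓝 p]
      ofComponents φ (fun x => Matrix.toEuclideanLin (A x) (V x)) := by
  filter_upwards [φ.open_source.mem_nhds hp] with q hq
  refine (isInvertible_coordDiff hφ hq).injective ?_
  rw [hL q hq, coordDiff_ofComponents hφ hq, coordDiff_ofComponents hφ hq]

variable [IsManifold (𝓡 3) ω M]

theorem vectorFieldAnalyticAt_ofComponents (hφ : φ ∈ IsManifold.maximalAtlas (𝓡 3) ω M)
    (hp : p ∈ φ.source) {V : Coord3 → Coord3} (hV : ContDiffAt ℝ ω V (φ p)) :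
    VectorFieldAnalyticAt (ofComponents φ V) p := by
  have := IsManifold.of_le (I := 𝓡 3) (M := M) (m := 1) (n := ω) (by simp)
  exact ContMDiffAt.mpullback_vectorField_preimage (n := ω)
    (contMDiffAt_vectorSpace_iff_contDiffAt.2 hV)
    (contMDiffAt_of_mem_maximalAtlas hφ hp) (isInvertible_coordDiff hφ hp) (by simp)

theorem coordDiff_mlieBracket_ofComponents (hφ : φ ∈ IsManifold.maximalAtlas (𝓡 3) ω M)
    (hp : p ∈ φ.source) {V W : Coord3 → Coord3} (hV : ContDiffAt ℝ 1 V (φ p))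
    (hW : ContDiffAt ℝ 1 W (φ p)) :
    coordDiff φ p (mlieBracket (𝓡 3) (ofComponents φ V) (ofComponents φ W) p) =
      lieBracket ℝ V W (φ p) := by
  have := IsManifold.of_le (I := 𝓡 3) (M := M) (m := minSmoothness ℝ 2) (n := ω) (by simp)
  have hpull := mpullback_mlieBracket (I := 𝓡 3) (I' := 𝓡 3) (n := ω) (f := φ) (x₀ := p)
    (V := V) (W := W)
    ((contMDiffAt_vectorSpace_iff_contDiffAt.2 hV).mdifferentiableAt one_ne_zero)
    ((contMDiffAt_vectorSpace_iff_contDiffAt.2 hW).mdifferentiableAt one_ne_zero)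
    (contMDiffAt_of_mem_maximalAtlas hφ hp) (by simp)
  have hflat : mlieBracket (𝓡 3) V W = lieBracket ℝ V W :=
    (mlieBracketWithin_univ (I := 𝓡 3) (V := V) (W := W)).symm.trans
      (mlieBracketWithin_eq_lieBracketWithin.trans lieBracketWithin_univ)
  exact (congrArg (coordDiff φ p) hpull.symm).trans
    ((coordDiff_ofComponents hφ hp _).trans (congrFun hflat _))

theorem coordDiff_nijenhuisTorsion_ofComponents (hφ : φ ∈ IsManifold.maximalAtlas (𝓡 3) ω M)
    (hp : p ∈ φ.source)
    (hL : ∀ q ∈ φ.source, ∀ v : TangentSpace (𝓡 3) q,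
      coordDiff φ q (L q v) = Matrix.toEuclideanLin (A (φ q)) (coordDiff φ q v))
    {V W : Coord3 → Coord3} (hV : ContDiffAt ℝ 1 V (φ p)) (hW : ContDiffAt ℝ 1 W (φ p))
    (hAV : ContDiffAt ℝ 1 (fun x => Matrix.toEuclideanLin (A x) (V x)) (φ p))
    (hAW : ContDiffAt ℝ 1 (fun x => Matrix.toEuclideanLin (A x) (W x)) (φ p)) :
    coordDiff φ p (nijenhuisTorsion L (ofComponents φ V) (ofComponents φ W) p) =
      flatNijenhuisTorsion ℝ (fun x => Matrix.toEuclideanLin (A x)) V W (φ p) := by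
  have hLV := eventuallyEq_ofComponents_of_coordDiff_apply hφ hp hL V
  have hLW := eventuallyEq_ofComponents_of_coordDiff_apply hφ hp hL W
  have hrefl : ∀ U : (q : M) → TangentSpace (𝓡 3) q, U =ᶠ[𝓝 p] U := fun _ => EventuallyEq.rfl
  unfold nijenhuisTorsion
  rw [hLV.mlieBracket_vectorField_eq hLW, hLV.mlieBracket_vectorField_eq (hrefl _),
    (hrefl _).mlieBracket_vectorField_eq hLW, map_sub, map_sub, map_add, hL p hp,
    hL p hp, hL p hp, hL p hp,
    coordDiff_mlieBracket_ofComponents hφ hp hAV hAW,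
    coordDiff_mlieBracket_ofComponents hφ hp hV hW,
    coordDiff_mlieBracket_ofComponents hφ hp hAV hW,
    coordDiff_mlieBracket_ofComponents hφ hp hV hAW, flatNijenhuisTorsion]

/-- The Nijenhuis torsion of `L` vanishes at `p`; as in `IsNijenhuisWithUnity`, this is tested on
vector fields that are analytic near `p`. -/
def IsNijenhuisAt (L : (p : M) → TangentSpace (𝓡 3) p →L[ℝ] TangentSpace (𝓡 3) p) (p : M) :
    Prop :=
  ∀ ξ η : (q : M) → TangentSpace (𝓡 3) q,
    VectorFieldAnalyticAt ξ p → VectorFieldAnalyticAt η p → nijenhuisTorsion L ξ η p = 0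

theorem IsNijenhuisAt.flatNijenhuisTorsion_const_eq_zero (hN : IsNijenhuisAt L p)
    (hφ : φ ∈ IsManifold.maximalAtlas (𝓡 3) ω M) (hp : p ∈ φ.source)
    (hL : ∀ q ∈ φ.source, ∀ v : TangentSpace (𝓡 3) q,
      coordDiff φ q (L q v) = Matrix.toEuclideanLin (A (φ q)) (coordDiff φ q v))
    {v w : Coord3} (hv : ContDiffAt ℝ 1 (fun x => Matrix.toEuclideanLin (A x) v) (φ p))
    (hw : ContDiffAt ℝ 1 (fun x => Matrix.toEuclideanLin (A x) w) (φ p)) :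
    flatNijenhuisTorsion ℝ (fun x => Matrix.toEuclideanLin (A x)) (fun _ => v) (fun _ => w)
      (φ p) = 0 := by
  rw [← coordDiff_nijenhuisTorsion_ofComponents hφ hp hL contDiffAt_const contDiffAt_const
    hv hw,
    hN _ _ (vectorFieldAnalyticAt_ofComponents hφ hp contDiffAt_const)
      (vectorFieldAnalyticAt_ofComponents hφ hp contDiffAt_const), map_zero]

end CoordinateExpressions

section EuclideanCoordinates

variable {𝕜 E ι : Type*} [RCLike 𝕜] [NormedAddCommGroup E] [NormedSpace 𝕜 E] {x : E}

theorem fderiv_euclidean_apply [Finite ι] {V : E → EuclideanSpace 𝕜 ι}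
    (hV : DifferentiableAt 𝕜 V x) (v : E) (i : ι) :
    fderiv 𝕜 V x v i = fderiv 𝕜 (fun y => V y i) x v := by
  have := Fintype.ofFinite ι
  exact congrArg (fun T : E →L[𝕜] 𝕜 => T v)
    ((EuclideanSpace.proj (𝕜 := 𝕜) i).hasFDerivAt.comp x hV.hasFDerivAt).fderiv.symm

variable {a b c : E → 𝕜}

theorem contDiffAt_euclidean_three {n : ℕ∞ω} (ha : ContDiffAt 𝕜 n a x) (hb : ContDiffAt 𝕜 n b x)
    (hc : ContDiffAt 𝕜 n c x) : ContDiffAt 𝕜 n (fun y => !₂[a y, b y, c y]) x := by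
  refine contDiffAt_euclidean.2 fun i => ?_
  fin_cases i
  exacts [ha, hb, hc]

theorem differentiableAt_euclidean_three (ha : DifferentiableAt 𝕜 a x)
    (hb : DifferentiableAt 𝕜 b x) (hc : DifferentiableAt 𝕜 c x) :
    DifferentiableAt 𝕜 (fun y => !₂[a y, b y, c y]) x := by
  refine differentiableAt_euclidean.2 fun i => ?_
  fin_cases i
  exacts [ha, hb, hc]

theorem fderiv_euclidean_three_apply (ha : DifferentiableAt 𝕜 a x) (hb : DifferentiableAt 𝕜 b x)
    (hc : DifferentiableAt 𝕜 c x) (v : E) :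
    fderiv 𝕜 (fun y => !₂[a y, b y, c y]) x v =
      !₂[fderiv 𝕜 a x v, fderiv 𝕜 b x v, fderiv 𝕜 c x v] := by
  ext i
  rw [fderiv_euclidean_apply (differentiableAt_euclidean_three ha hb hc)]
  fin_cases i <;> rfl

end EuclideanCoordinates

section SpaceCoordinates

variable {g : ℝ × ℝ → ℝ} {x : Coord3}

theorem hasFDerivAt_coord (x : Coord3) (i : Fin 3) :
    HasFDerivAt (fun y : Coord3 => y i) (EuclideanSpace.proj (𝕜 := ℝ) i : Coord3 →L[ℝ] ℝ) x :=
  (EuclideanSpace.proj (𝕜 := ℝ) i : Coord3 →L[ℝ] ℝ).hasFDerivAt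

theorem contDiffAt_coord {n : ℕ∞ω} (x : Coord3) (i : Fin 3) :
    ContDiffAt ℝ n (fun y : Coord3 => y i) x :=
  (EuclideanSpace.proj (𝕜 := ℝ) i : Coord3 →L[ℝ] ℝ).contDiff.contDiffAt

theorem hasFDerivAt_comp_coords (hg : DifferentiableAt ℝ g (x 1, x 2)) :
    HasFDerivAt (fun y : Coord3 => g (y 1, y 2)) ((fderiv ℝ g (x 1, x 2)).comp
      ((EuclideanSpace.proj (𝕜 := ℝ) 1 : Coord3 →L[ℝ] ℝ).prod (EuclideanSpace.proj 2))) x :=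
  hg.hasFDerivAt.comp (f := fun y : Coord3 => (y 1, y 2)) x
    ((hasFDerivAt_coord x 1).prodMk (hasFDerivAt_coord x 2))

theorem contDiffAt_comp_coords {n : ℕ∞ω} (hg : ContDiffAt ℝ n g (x 1, x 2)) :
    ContDiffAt ℝ n (fun y : Coord3 => g (y 1, y 2)) x :=
  hg.comp (f := fun y : Coord3 => (y 1, y 2)) x
    ((contDiffAt_coord x 1).prodMk (contDiffAt_coord x 2))

end SpaceCoordinates

section SemiNormalForm

variable {ε lam0 : ℝ} {k : ℕ} {f g : ℝ × ℝ → ℝ} {x : Coord3}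

theorem toEuclideanLin_semiNormalMatrix (ε : ℝ) (k : ℕ) (lam0 : ℝ) (f g : ℝ × ℝ → ℝ)
    (x v : Coord3) :
    Matrix.toEuclideanLin (semiNormalMatrix ε k lam0 f g x) v =
      !₂[(x 0 + lam0) * v 0, x 1 / k * v 0 + (ε * x 1 ^ k + x 0 + lam0) * v 1,
        f (x 1, x 2) * v 0 + g (x 1, x 2) * v 1 + (ε * x 1 ^ k + x 0 + lam0) * v 2] := by
  ext i
  fin_cases i <;>
    simp [semiNormalMatrix, Matrix.toLpLin_apply, dotProduct, Fin.sum_univ_three]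

theorem toEuclideanLin_semiNormalMatrix_single_zero (ε : ℝ) (k : ℕ) (lam0 : ℝ) (f g : ℝ × ℝ → ℝ)
    (x : Coord3) :
    Matrix.toEuclideanLin (semiNormalMatrix ε k lam0 f g x) (EuclideanSpace.single 0 1) =
      !₂[x 0 + lam0, x 1 / k, f (x 1, x 2)] := by
  simp [toEuclideanLin_semiNormalMatrix]

theorem toEuclideanLin_semiNormalMatrix_single_one (ε : ℝ) (k : ℕ) (lam0 : ℝ) (f g : ℝ × ℝ → ℝ)
    (x : Coord3) :
    Matrix.toEuclideanLin (semiNormalMatrix ε k lam0 f g x) (EuclideanSpace.single 1 1) =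
      !₂[0, ε * x 1 ^ k + x 0 + lam0, g (x 1, x 2)] := by
  simp [toEuclideanLin_semiNormalMatrix]

theorem contDiffAt_semiNormalMatrix_single_zero {n : ℕ∞ω} (hf : ContDiffAt ℝ n f (x 1, x 2)) :
    ContDiffAt ℝ n (fun y => Matrix.toEuclideanLin (semiNormalMatrix ε k lam0 f g y)
      (EuclideanSpace.single 0 1)) x := by
  simp only [toEuclideanLin_semiNormalMatrix_single_zero]
  exact contDiffAt_euclidean_three ((contDiffAt_coord x 0).add contDiffAt_const)
    ((contDiffAt_coord x 1).div_const _) (contDiffAt_comp_coords hf)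

theorem contDiffAt_semiNormalMatrix_single_one {n : ℕ∞ω} (hg : ContDiffAt ℝ n g (x 1, x 2)) :
    ContDiffAt ℝ n (fun y => Matrix.toEuclideanLin (semiNormalMatrix ε k lam0 f g y)
      (EuclideanSpace.single 1 1)) x := by
  simp only [toEuclideanLin_semiNormalMatrix_single_one]
  exact contDiffAt_euclidean_three contDiffAt_const
    (((contDiffAt_const.mul ((contDiffAt_coord x 1).pow k)).add (contDiffAt_coord x 0)).add
      contDiffAt_const) (contDiffAt_comp_coords hg)

theorem fderiv_semiNormalMatrix_single_zero (hf : DifferentiableAt ℝ f (x 1, x 2)) (v : Coord3) :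
    fderiv ℝ (fun y => Matrix.toEuclideanLin (semiNormalMatrix ε k lam0 f g y)
      (EuclideanSpace.single 0 1)) x v = !₂[v 0, v 1 / k, fderiv ℝ f (x 1, x 2) (v 1, v 2)] := by
  simp only [toEuclideanLin_semiNormalMatrix_single_zero]
  have h0 : HasFDerivAt (fun y : Coord3 => y 0 + lam0) _ x := (hasFDerivAt_coord x 0).add_const lam0
  have h1 : HasFDerivAt (fun y : Coord3 => y 1 / k) _ x :=
    (hasFDerivAt_coord x 1).mul_const (k : ℝ)⁻¹
  rw [fderiv_euclidean_three_apply h0.differentiableAt h1.differentiableAt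
    (hasFDerivAt_comp_coords hf).differentiableAt, h0.fderiv, h1.fderiv,
    (hasFDerivAt_comp_coords hf).fderiv]
  simp [div_eq_inv_mul]

theorem fderiv_semiNormalMatrix_single_one (hg : DifferentiableAt ℝ g (x 1, x 2)) (v : Coord3) :
    fderiv ℝ (fun y => Matrix.toEuclideanLin (semiNormalMatrix ε k lam0 f g y)
      (EuclideanSpace.single 1 1)) x v =
      !₂[0, ε * (k * x 1 ^ (k - 1) * v 1) + v 0, fderiv ℝ g (x 1, x 2) (v 1, v 2)] := by
  simp only [toEuclideanLin_semiNormalMatrix_single_one]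
  have h1 : HasFDerivAt (fun y : Coord3 => ε * y 1 ^ k + y 0 + lam0) _ x :=
    ((((hasFDerivAt_coord x 1).pow k).const_mul ε).add (hasFDerivAt_coord x 0)).add_const lam0
  rw [fderiv_euclidean_three_apply (differentiableAt_const 0) h1.differentiableAt
    (hasFDerivAt_comp_coords hg).differentiableAt, h1.fderiv,
    (hasFDerivAt_comp_coords hg).fderiv]
  simp

/-- With `X = (y₁ / k) ∂₁ + f ∂₂` and `Y = g ∂₂`, the right-hand side is the `∂₂`-component of
`[X, Y] - (1 - 1 / k) Y`. -/
theorem flatNijenhuisTorsion_semiNormalMatrix (hf : DifferentiableAt ℝ f (x 1, x 2))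
    (hg : DifferentiableAt ℝ g (x 1, x 2)) :
    flatNijenhuisTorsion ℝ
        (fun y => Matrix.toEuclideanLin (semiNormalMatrix ε k lam0 f g y))
        (fun _ => EuclideanSpace.single 0 1) (fun _ => EuclideanSpace.single 1 1) x 2 =
      fderiv ℝ g (x 1, x 2) (x 1 / k, f (x 1, x 2)) - fderiv ℝ f (x 1, x 2) (0, g (x 1, x 2))
        - (1 - 1 / (k : ℝ)) * g (x 1, x 2) := by
  rw [flatNijenhuisTorsion_const, fderiv_semiNormalMatrix_single_zero hf,
    fderiv_semiNormalMatrix_single_one hg, fderiv_semiNormalMatrix_single_zero hf,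
    fderiv_semiNormalMatrix_single_one hg]
  have hf₁ : ∀ c d : ℝ, fderiv ℝ f (x 1, x 2) (c, d) =
      c * fderiv ℝ f (x 1, x 2) (1, 0) + fderiv ℝ f (x 1, x 2) (0, d) := fun c d => by
    rw [← smul_eq_mul, ← map_smul, ← map_add]
    simp
  have hg₀ : fderiv ℝ g (x 1, x 2) (0, 0) = 0 := map_zero _
  simp only [toEuclideanLin_semiNormalMatrix_single_zero,
    toEuclideanLin_semiNormalMatrix_single_one]
  rw [toEuclideanLin_semiNormalMatrix, toEuclideanLin_semiNormalMatrix]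
  simp only [PiLp.add_apply, PiLp.sub_apply, Matrix.cons_val, PiLp.single_eq_same, ne_eq,
    PiLp.single_eq_of_ne, zero_ne_one, one_ne_zero, Fin.reduceEq, not_false_eq_true, hg₀,
    hf₁ (ε * x 1 ^ k + x 0 + lam0)]
  ring

variable {M : Type*} [TopologicalSpace M] [ChartedSpace Coord3 M] [IsManifold (𝓡 3) ω M]
  {φ : OpenPartialHomeomorph M Coord3} {p : M}
  {L : (p : M) → TangentSpace (𝓡 3) p →L[ℝ] TangentSpace (𝓡 3) p}
  {e : (p : M) → TangentSpace (𝓡 3) p}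

theorem IsNijenhuisAt.fderiv_sub_fderiv_eq_of_hasCoordForm (hN : IsNijenhuisAt L p)
    (hform : HasCoordForm L e φ (semiNormalMatrix ε k lam0 f g))
    (hφ : φ ∈ IsManifold.maximalAtlas (𝓡 3) ω M) (hp : p ∈ φ.source) {y : ℝ × ℝ}
    (hy : (φ p 1, φ p 2) = y) (hf : ContDiffAt ℝ 1 f y) (hg : ContDiffAt ℝ 1 g y) :
    fderiv ℝ g y (y.1 / k, f y) - fderiv ℝ f y (0, g y) = (1 - 1 / (k : ℝ)) * g y := by
  subst hy
  have htor := hN.flatNijenhuisTorsion_const_eq_zero hφ hp (fun q hq => (hform q hq).2)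
    (contDiffAt_semiNormalMatrix_single_zero hf) (contDiffAt_semiNormalMatrix_single_one hg)
  rw [← sub_eq_zero, ← flatNijenhuisTorsion_semiNormalMatrix (hf.differentiableAt one_ne_zero)
    (hg.differentiableAt one_ne_zero), htor]
  rfl

theorem eventually_fderiv_sub_fderiv_eq_of_hasCoordForm (hN : ∀ᶠ q in 𝓝 p, IsNijenhuisAt L q)
    (hform : HasCoordForm L e φ (semiNormalMatrix ε k lam0 f g))
    (hφ : φ ∈ IsManifold.maximalAtlas (𝓡 3) ω M) (hp : p ∈ φ.source) (hp₀ : φ p = 0)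
    (hf : AnalyticAt ℝ f 0) (hg : AnalyticAt ℝ g 0) :
    ∀ᶠ y in 𝓝 0,
      fderiv ℝ g y (y.1 / k, f y) - fderiv ℝ f y (0, g y) = (1 - 1 / (k : ℝ)) * g y := by
  have hslice : Tendsto (fun y : ℝ × ℝ => (!₂[0, y.1, y.2] : Coord3)) (𝓝 0) (𝓝 (φ p)) := by
    have hcont : Continuous fun y : ℝ × ℝ => (!₂[0, y.1, y.2] : Coord3) := by fun_prop
    have h0 : (!₂[0, 0, 0] : Coord3) = φ p := by
      rw [hp₀]
      ext i
      fin_cases i <;> rfl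
    exact h0 ▸ hcont.tendsto 0
  filter_upwards [hslice.eventually (φ.open_target.mem_nhds (φ.map_source hp)),
    ((φ.tendsto_symm hp).comp hslice).eventually hN, hf.eventually_analyticAt,
    hg.eventually_analyticAt] with y hyφ hNy hfy hgy
  exact hNy.fderiv_sub_fderiv_eq_of_hasCoordForm hform hφ (φ.map_target hyφ)
    (by rw [Function.comp_apply, φ.right_inv hyφ]; rfl) hfy.contDiffAt hgy.contDiffAt

end SemiNormalForm

section LocalDiffeomorphisms

theorem exists_openPartialHomeomorph_of_contDiffAt {𝕜 E : Type*} [RCLike 𝕜]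
    [NormedAddCommGroup E] [NormedSpace 𝕜 E] [CompleteSpace E] {F : E → E} {x : E} {U : Set E}
    {n : ℕ∞ω} (hn : n ≠ 0) (hn' : n ≠ ∞) (hF : ContDiffAt 𝕜 n F x)
    (hF' : (fderiv 𝕜 F x).IsInvertible) (hU : U ∈ 𝓝 x) :
    ∃ Θ : OpenPartialHomeomorph E E, ⇑Θ = F ∧ x ∈ Θ.source ∧ Θ.source ⊆ U ∧
      ContDiffOn 𝕜 n Θ Θ.source ∧ ContDiffOn 𝕜 n Θ.symm Θ.target := by
  obtain ⟨D, hD⟩ := hF'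
  have hFD : HasFDerivAt F (D : E →L[𝕜] E) x := hD ▸ (hF.differentiableAt hn).hasFDerivAt
  let T := hF.toOpenPartialHomeomorph F hFD hn
  let Θ := T.restrContDiff 𝕜 n hn'
  have hxΘ : x ∈ Θ.source :=
    ⟨hF.mem_toOpenPartialHomeomorph_source hFD hn, hF, hF.to_localInverse hFD hn⟩
  have hsource := Θ.restrOpen_source (interior U) isOpen_interior
  refine ⟨Θ.restrOpen (interior U) isOpen_interior, rfl, ?_, ?_, ?_, ?_⟩
  · exact hsource ▸ ⟨hxΘ, mem_interior_iff_mem_nhds.2 hU⟩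
  · exact hsource ▸ Set.inter_subset_right.trans interior_subset
  · exact (T.contDiffOn_restrContDiff_source _ _).mono (hsource ▸ Set.inter_subset_left)
  · exact (T.contDiffOn_restrContDiff_target _ _).mono fun y hy => hy.1

theorem trans_mem_maximalAtlas {𝕜 E M : Type*} [NontriviallyNormedField 𝕜]
    [NormedAddCommGroup E] [NormedSpace 𝕜 E] [TopologicalSpace M] [ChartedSpace E M] {n : ℕ∞ω}
    [IsManifold 𝓘(𝕜, E) n M] {φ : OpenPartialHomeomorph M E}
    (hφ : φ ∈ IsManifold.maximalAtlas 𝓘(𝕜, E) n M) {Θ : OpenPartialHomeomorph E E}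
    (hΘ : ContDiffOn 𝕜 n Θ Θ.source) (hΘ' : ContDiffOn 𝕜 n Θ.symm Θ.target) :
    φ.trans Θ ∈ IsManifold.maximalAtlas 𝓘(𝕜, E) n M := by
  refine OpenPartialHomeomorph.mem_maximalAtlas_of_contMDiffOn _ ?_ ?_
  · exact hΘ.contMDiffOn.comp' (contMDiffOn_of_mem_maximalAtlas hφ)
  · exact (contMDiffOn_symm_of_mem_maximalAtlas hφ).comp' hΘ'.contMDiffOn

end LocalDiffeomorphisms

section ReplaceThird

variable {Z f g f' g' : ℝ × ℝ → ℝ} {ε lam0 : ℝ} {k : ℕ} {x : Coord3}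

/-- The change of variables `(x¹, x², x³) ↦ (x¹, x², Z(x², x³))`, which keeps the first two
coordinates and takes `Z` as the new third one. -/
noncomputable def replaceThird (Z : ℝ × ℝ → ℝ) (x : Coord3) : Coord3 :=
  !₂[x 0, x 1, Z (x 1, x 2)]

theorem contDiffAt_replaceThird {n : ℕ∞ω} (hZ : ContDiffAt ℝ n Z (x 1, x 2)) :
    ContDiffAt ℝ n (replaceThird Z) x :=
  contDiffAt_euclidean_three (contDiffAt_coord x 0) (contDiffAt_coord x 1)
    (contDiffAt_comp_coords hZ)

theorem differentiableAt_replaceThird (hZ : DifferentiableAt ℝ Z (x 1, x 2)) :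
    DifferentiableAt ℝ (replaceThird Z) x :=
  differentiableAt_euclidean_three (hasFDerivAt_coord x 0).differentiableAt
    (hasFDerivAt_coord x 1).differentiableAt (hasFDerivAt_comp_coords hZ).differentiableAt

theorem fderiv_replaceThird_apply (hZ : DifferentiableAt ℝ Z (x 1, x 2)) (v : Coord3) :
    fderiv ℝ (replaceThird Z) x v = !₂[v 0, v 1, fderiv ℝ Z (x 1, x 2) (v 1, v 2)] := by
  have h := fderiv_euclidean_three_apply (hasFDerivAt_coord x 0).differentiableAt
    (hasFDerivAt_coord x 1).differentiableAt (hasFDerivAt_comp_coords hZ).differentiableAt v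
  rwa [(hasFDerivAt_coord x 0).fderiv, (hasFDerivAt_coord x 1).fderiv,
    (hasFDerivAt_comp_coords hZ).fderiv] at h

theorem isInvertible_fderiv_replaceThird (hZ : DifferentiableAt ℝ Z (x 1, x 2))
    (hZ₂ : fderiv ℝ Z (x 1, x 2) (0, 1) ≠ 0) : (fderiv ℝ (replaceThird Z) x).IsInvertible := by
  have hinj : Function.Injective (fderiv ℝ (replaceThird Z) x : Coord3 →ₗ[ℝ] Coord3) := by
    refine (injective_iff_map_eq_zero _).2 fun v hv => ?_
    have hv' : !₂[v 0, v 1, fderiv ℝ Z (x 1, x 2) (v 1, v 2)] = (0 : Coord3) :=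
      (fderiv_replaceThird_apply hZ v).symm.trans hv
    have h0 : v 0 = 0 := congrArg (fun w : Coord3 => w 0) hv'
    have h1 : v 1 = 0 := congrArg (fun w : Coord3 => w 1) hv'
    have h2 : fderiv ℝ Z (x 1, x 2) (v 1, v 2) = 0 := congrArg (fun w : Coord3 => w 2) hv'
    rw [h1, map_zero_prodMk, mul_eq_zero, or_iff_left hZ₂] at h2
    ext i
    fin_cases i
    exacts [h0, h1, h2]
  exact ⟨(LinearEquiv.ofInjectiveEndo _ hinj).toContinuousLinearEquiv, rfl⟩

theorem fderiv_replaceThird_semiNormalMatrix (hZ : DifferentiableAt ℝ Z (x 1, x 2))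
    (hf : fderiv ℝ Z (x 1, x 2) (x 1 / k, f (x 1, x 2)) = f' (x 1, Z (x 1, x 2)))
    (hg : fderiv ℝ Z (x 1, x 2) (0, g (x 1, x 2)) = g' (x 1, Z (x 1, x 2))) (v : Coord3) :
    fderiv ℝ (replaceThird Z) x
        (Matrix.toEuclideanLin (semiNormalMatrix ε k lam0 f g x) v) =
      Matrix.toEuclideanLin (semiNormalMatrix ε k lam0 f' g' (replaceThird Z x))
        (fderiv ℝ (replaceThird Z) x v) := by
  set μ := ε * x 1 ^ k + x 0 + lam0
  have hlin : fderiv ℝ Z (x 1, x 2) (x 1 / k * v 0 + μ * v 1,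
      f (x 1, x 2) * v 0 + g (x 1, x 2) * v 1 + μ * v 2) =
      f' (x 1, Z (x 1, x 2)) * v 0 + g' (x 1, Z (x 1, x 2)) * v 1 +
        μ * fderiv ℝ Z (x 1, x 2) (v 1, v 2) := by
    have hsplit : (x 1 / k * v 0 + μ * v 1,
        f (x 1, x 2) * v 0 + g (x 1, x 2) * v 1 + μ * v 2) =
        v 0 • (x 1 / k, f (x 1, x 2)) + v 1 • (0, g (x 1, x 2)) + μ • (v 1, v 2) := by
      refine Prod.ext ?_ ?_ <;> simp only [Prod.smul_mk, Prod.mk_add_mk, smul_eq_mul] <;> ring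
    rw [hsplit, map_add, map_add, map_smul, map_smul, map_smul, hf, hg, smul_eq_mul, smul_eq_mul,
      smul_eq_mul, mul_comm (v 0), mul_comm (v 1)]
  simp only [toEuclideanLin_semiNormalMatrix, fderiv_replaceThird_apply hZ]
  ext i
  fin_cases i
  · rfl
  · rfl
  · exact hlin

variable {M : Type*} [TopologicalSpace M] [ChartedSpace Coord3 M]
  {φ : OpenPartialHomeomorph M Coord3}
  {L : (p : M) → TangentSpace (𝓡 3) p →L[ℝ] TangentSpace (𝓡 3) p}
  {e : (p : M) → TangentSpace (𝓡 3) p}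

theorem HasCoordForm.trans_replaceThird
    (hform : HasCoordForm L e φ (semiNormalMatrix ε k lam0 f g))
    (hφ : φ ∈ IsManifold.maximalAtlas (𝓡 3) ω M) {Θ : OpenPartialHomeomorph Coord3 Coord3}
    (hΘ : ⇑Θ = replaceThird Z)
    (hZ : ∀ x ∈ Θ.source, DifferentiableAt ℝ Z (x 1, x 2) ∧
      fderiv ℝ Z (x 1, x 2) (x 1 / k, f (x 1, x 2)) = f' (x 1, Z (x 1, x 2)) ∧
      fderiv ℝ Z (x 1, x 2) (0, g (x 1, x 2)) = g' (x 1, Z (x 1, x 2))) :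
    HasCoordForm L e (φ.trans Θ) (semiNormalMatrix ε k lam0 f' g') := by
  refine hform.trans hφ ?_ ?_ ?_ <;> rw [hΘ] <;> intro x hx <;>
    obtain ⟨hZx, hfx, hgx⟩ := hZ x hx
  · exact differentiableAt_replaceThird hZx
  · have h0 : fderiv ℝ Z (x 1, x 2) (0, 0) = 0 := map_zero _
    rw [fderiv_replaceThird_apply hZx]
    ext i
    fin_cases i <;> simp [h0]
  · exact fderiv_replaceThird_semiNormalMatrix hZx hfx hgx

end ReplaceThird

theorem mainTheorem7_general {M : Type*} [TopologicalSpace M] [ChartedSpace Coord3 M]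
    [IsManifold (𝓡 3) ω M]
    {L : (p : M) → TangentSpace (𝓡 3) p →L[ℝ] TangentSpace (𝓡 3) p}
    {e : (p : M) → TangentSpace (𝓡 3) p} {p₀ : M} (hN : ∀ᶠ p in 𝓝 p₀, IsNijenhuisAt L p)
    {ε lam0 : ℝ} {k : ℕ} (hk : 1 ≤ k) {f g : ℝ × ℝ → ℝ}
    (hf : AnalyticAt ℝ f 0) (hg : AnalyticAt ℝ g 0) {φ : OpenPartialHomeomorph M Coord3}
    (hφ : φ ∈ IsManifold.maximalAtlas (𝓡 3) ω M) (hp₀ : p₀ ∈ φ.source) (hφ₀ : φ p₀ = 0)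
    (hform : HasCoordForm L e φ (semiNormalMatrix ε k lam0 f g))
    (hg₀ : g 0 ≠ 0) (hf₀ : k = 1 → f 0 = 0) :
    ∃ ψ ∈ IsManifold.maximalAtlas (𝓡 3) ω M,
      p₀ ∈ ψ.source ∧ (∀ p, ψ p 0 = φ p 0 ∧ ψ p 1 = φ p 1) ∧ (f 0 = 0 → ψ p₀ 2 = 0) ∧
      HasCoordForm L e ψ
        (semiNormalMatrix ε k lam0 (fun y => (1 - (k : ℝ)) / k * y.2) (fun _ => 1)) := by
  obtain ⟨Z, hZ, hZ₀, hZe⟩ := exists_analyticAt_rectifying hk hf hg hg₀ hf₀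
    (eventually_fderiv_sub_fderiv_eq_of_hasCoordForm hN hform hφ hp₀ hφ₀ hf hg)
  have hZ₂ : fderiv ℝ Z 0 (0, 1) ≠ 0 := by
    have h := hZe.self_of_nhds.2
    rw [map_zero_prodMk] at h
    exact right_ne_zero_of_mul_eq_one h
  have hproj : Tendsto (fun x : Coord3 => (x 1, x 2)) (𝓝 0) (𝓝 0) :=
    Continuous.tendsto (by fun_prop) 0
  obtain ⟨Θ, hΘ, h0Θ, hΘU, hΘs, hΘt⟩ := exists_openPartialHomeomorph_of_contDiffAt (n := ω)
    (by simp) (by simp) (contDiffAt_replaceThird (x := 0) hZ.contDiffAt)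
    (isInvertible_fderiv_replaceThird (x := 0) hZ.differentiableAt hZ₂)
    (hproj.eventually (hZ.eventually_analyticAt.and hZe))
  have hψ : ⇑(φ.trans Θ) = replaceThird Z ∘ φ := by rw [OpenPartialHomeomorph.coe_trans, hΘ]
  refine ⟨φ.trans Θ, trans_mem_maximalAtlas hφ hΘs hΘt, ?_, fun p => ?_, fun h => ?_, ?_⟩
  · exact ⟨hp₀, show φ p₀ ∈ Θ.source by rwa [hφ₀]⟩
  · exact hψ ▸ ⟨rfl, rfl⟩
  · rw [hψ, Function.comp_apply, hφ₀]
    exact hZ₀ h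
  · exact hform.trans_replaceThird hφ hΘ fun x hx => (hΘU hx).imp_left AnalyticAt.differentiableAt

theorem mainTheorem7 {M : Type*} [TopologicalSpace M] [ChartedSpace Coord3 M]
    [IsManifold (𝓡 3) ω M]
    (L : (p : M) → TangentSpace (𝓡 3) p →L[ℝ] TangentSpace (𝓡 3) p)
    (e : (p : M) → TangentSpace (𝓡 3) p) (hLe : IsNijenhuisWithUnity L e)
    (p₀ : M) (ε : ℝ) (hε : ε = 1 ∨ ε = -1) (k : ℕ) (hk : 1 ≤ k) (lam0 : ℝ)
    (f g : ℝ × ℝ → ℝ) (hf : AnalyticAt ℝ f (0, 0)) (hg : AnalyticAt ℝ g (0, 0))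
    (φ : OpenPartialHomeomorph M Coord3)
    (hφ : φ ∈ IsManifold.maximalAtlas (𝓡 3) ω M)
    (hp₀ : p₀ ∈ φ.source) (hφ₀ : φ p₀ = 0)
    (hform : HasCoordForm L e φ (semiNormalMatrix ε k lam0 f g))
    (hg₀ : g (0, 0) ≠ 0) (hf₀ : k = 1 → f (0, 0) = 0) :
    ∃ ψ ∈ IsManifold.maximalAtlas (𝓡 3) ω M,
      p₀ ∈ ψ.source ∧ ψ p₀ 0 = 0 ∧ ψ p₀ 1 = 0 ∧ (f (0, 0) = 0 → ψ p₀ 2 = 0) ∧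
      HasCoordForm L e ψ
        (semiNormalMatrix ε k lam0 (fun y => (1 - (k : ℝ)) / k * y.2) (fun _ => 1)) := by
  obtain ⟨ψ, hψ, hp, h01, h2, hLe'⟩ := mainTheorem7_general
    (Eventually.of_forall hLe.torsion_eq_zero) hk hf hg hφ hp₀ hφ₀ hform hg₀ hf₀
  exact ⟨ψ, hψ, hp, by simp [h01, hφ₀], by simp [h01, hφ₀], h2, hLe'⟩
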